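/- Let $n\ge 1$, let $\mathbb S^n\subset\mathbb R^{n+1}$ be the unit sphere with its round distance $d(x,y)=\arccos\langle x,y\rangle$, and for a unit vector $v$ let $\Phi_v:\mathbb S^n\to\mathbb S^n$ be the folding map along the equator $v^\perp\cap\mathbb S^n$: $\Phi_v(x)=x$ if $\langle v,x\rangle\ge 0$, and $\Phi_v(x)=x-2\langle v,x\rangle v$ if $\langle v,x\rangle<0$. A closed subset $\Sigma\subset\mathbb S^n$ has the wrapping property if there is a map $h:\mathbb S^n\to\mathbb S^n$, $1$-Lipschitz for $d$, such that $\deg h\neq 1$ and, on each connected component of $\Sigma$, $h$ is equal to (the restriction of) an element of $\mathrm{SO}(n+1)$. Here $\deg h$ is the integer by which $h$ acts on $H_n(\mathbb S^n;\mathbb Z)\cong\mathbb Z$. Proposition. Every finite subset $\Sigma$ of $\mathbb S^n$ has the wrapping property. Moreover, the map $h$ can be chosen such that every $p\in\Sigma$ has a neighbourhood in $\mathbb S^n$ on which $h$ agrees with an element of $\mathrm{SO}(n+1)$, and such that $h$ is a composition of finitely many (at least one) folding maps along equators. -/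

import Mathlib

open scoped Topology

/-- Euclidean space `ℝ^{n+1}`. -/
abbrev EucSpace (n : ℕ) : Type := EuclideanSpace ℝ (Fin (n + 1))

/-- The unit sphere `𝕊ⁿ` in `ℝ^{n+1}`. -/
abbrev UnitSphere (n : ℕ) : Type := Metric.sphere (0 : EucSpace n) 1

/-- The distance of the round metric on `𝕊ⁿ`: the angle `arccos ⟨x, y⟩`, with values in `[0, π]`. -/
noncomputable def roundDist {n : ℕ} (x y : UnitSphere n) : ℝ :=
  InnerProductGeometry.angle (x : EucSpace n) (y : EucSpace n)

/-- The integral singular homology group `H_n(𝕊ⁿ; ℤ)` in the top degree. -/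
noncomputable def topHomology (n : ℕ) : ModuleCat.{0} ℤ :=
  ((AlgebraicTopology.singularHomologyFunctor.{0} (ModuleCat.{0} ℤ) n).obj
    (ModuleCat.of ℤ ℤ)).obj (TopCat.of (UnitSphere n))

/-- The endomorphism of `H_n(𝕊ⁿ; ℤ)` induced by a continuous self-map of `𝕊ⁿ`. -/
noncomputable def topHomologyMap {n : ℕ} (h : C(UnitSphere n, UnitSphere n)) :
    topHomology n ⟶ topHomology n :=
  ((AlgebraicTopology.singularHomologyFunctor.{0} (ModuleCat.{0} ℤ) n).obj
    (ModuleCat.of ℤ ℤ)).map (TopCat.ofHom h)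

/-- `HasDegree h d`: the continuous map `h : 𝕊ⁿ → 𝕊ⁿ` (`n ≥ 1`) has degree `d`, that is, it acts on
`H_n(𝕊ⁿ; ℤ) ≅ ℤ` as multiplication by the integer `d`. -/
def HasDegree {n : ℕ} (h : C(UnitSphere n, UnitSphere n)) (d : ℤ) : Prop :=
  ∀ c : topHomology n, (topHomologyMap h).hom c = d • c

/-- `h` is a witness of the wrapping property of `K ⊆ 𝕊ⁿ`: it is `1`-Lipschitz for the round
distance, its degree is not `1`, and on each connected component of `K` it equals an element of
`SO(n+1)`. -/
structure IsWrappingMap {n : ℕ} (K : Set (UnitSphere n)) (h : C(UnitSphere n, UnitSphere n)) :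
    Prop where
  lipschitz : ∀ x y, roundDist (h x) (h y) ≤ roundDist x y
  degree_ne_one : ∃ d : ℤ, HasDegree h d ∧ d ≠ 1
  rotation_on_components : ∀ p ∈ K, ∃ A ∈ Matrix.specialOrthogonalGroup (Fin (n + 1)) ℝ,
    ∀ x ∈ connectedComponentIn K p, (h x : EucSpace n) = Matrix.toEuclideanLin A x

open Classical in
/-- The folding map along the equator orthogonal to the unit vector `v`: the identity on the closed
hemisphere `⟨v, x⟩ ≥ 0`, and the reflection in the hyperplane `v^⊥` on the other one. -/
noncomputable def foldingMap {n : ℕ} (v x : UnitSphere n) : UnitSphere n :=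
  if 0 ≤ inner ℝ (v : EucSpace n) (x : EucSpace n) then x
  else ⟨(ℝ ∙ (v : EucSpace n))ᗮ.reflection (x : EucSpace n), by simp⟩

/-- Compositions of one or more folding maps along equators. -/
inductive IsFoldingComposition {n : ℕ} : (UnitSphere n → UnitSphere n) → Prop
  | fold (v : UnitSphere n) : IsFoldingComposition (foldingMap v)
  | comp (v : UnitSphere n) (f : UnitSphere n → UnitSphere n) (hf : IsFoldingComposition f) :
      IsFoldingComposition (foldingMap v ∘ f)

/-!
The folds used here are all along equators with normal in one fixed plane `P ⊆ ℝ^{n+1}`, spanned by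
orthonormal `u₁, u₂` with `u₁` not orthogonal to any point of `K`. Such a fold acts only on the
polar angle `θ` of the projection to `P`: folding at the angle `a` sends `θ` to `a + |θ - a|` when
`|θ - a| < π` (`exists_fold_at_angle`). Near a point off the equator it is the identity or a
reflection, so near each `p ∈ K` the composition is a linear isometry whose determinant is a sign
(`IsLocallyIsometryOfSign`), and all signs have to be made `1`. This is a one-dimensional problem
about finitely many angles, each with a sign (`HasAngularOrientation`).

A fold at a generic small angle `a > 0` brings all angles into the interval `(a, a + π)` without
identifying a reflected angle with an unreflected one, so the sign is a function of the angle
(`exists_generic_fold`). Then one inducts on the number of angles: the smallest angle can be merged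
into the next one by folding at their midpoint, which makes the signs agree if they were different
before, and if they were equal, a preliminary fold just above the smallest angle changes its sign
(`exists_foldingComposition_sign_eq_one`).

Folds are `1`-Lipschitz. The image of a composition of folds lies in a closed hemisphere, which can
be contracted inside the sphere to a point, so the composition is nullhomotopic and has degree `0`
(`hasDegree_zero_of_inner_nonneg`).
-/

open CategoryTheory Filter

/-! ### Folding maps -/

section Folding

variable {n : ℕ}

lemma reflection_orthogonal_unitSphere (v : UnitSphere n) (x : EucSpace n) :
    (ℝ ∙ (v : EucSpace n))ᗮ.reflection x
      = x - (2 * inner ℝ (v : EucSpace n) x) • (v : EucSpace n) := by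
  rw [Submodule.reflection_orthogonal_apply, Submodule.reflection_singleton_apply]
  simp only [norm_eq_of_mem_sphere, RCLike.ofReal_real_eq_id, id, one_pow, div_one]
  module

lemma foldingMap_of_nonneg {v x : UnitSphere n}
    (h : 0 ≤ inner ℝ (v : EucSpace n) (x : EucSpace n)) : foldingMap v x = x := if_pos h

lemma coe_foldingMap_of_neg {v x : UnitSphere n}
    (h : inner ℝ (v : EucSpace n) (x : EucSpace n) < 0) :
    (foldingMap v x : EucSpace n) = (ℝ ∙ (v : EucSpace n))ᗮ.reflection (x : EucSpace n) := by
  simp [foldingMap, not_le.2 h]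

lemma coe_foldingMap (v x : UnitSphere n) :
    (foldingMap v x : EucSpace n)
      = x - (2 * min (inner ℝ (v : EucSpace n) (x : EucSpace n)) 0) • (v : EucSpace n) := by
  rcases le_or_gt 0 (inner ℝ (v : EucSpace n) (x : EucSpace n)) with h | h
  · simp [foldingMap_of_nonneg h, min_eq_right h]
  · rw [coe_foldingMap_of_neg h, reflection_orthogonal_unitSphere, min_eq_left h.le]

lemma inner_self_unitSphere (v : UnitSphere n) :
    inner ℝ (v : EucSpace n) (v : EucSpace n) = 1 := by
  rw [real_inner_self_eq_norm_sq, norm_eq_of_mem_sphere, one_pow]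

lemma continuous_foldingMap (v : UnitSphere n) : Continuous (foldingMap v) := by
  refine Continuous.subtype_mk (p := (· ∈ Metric.sphere (0 : EucSpace n) 1))
    (f := fun x => (foldingMap v x : EucSpace n)) ?_ fun x => (foldingMap v x).2
  simp only [coe_foldingMap]
  fun_prop

lemma inner_foldingMap_nonneg (v x : UnitSphere n) :
    0 ≤ inner ℝ (v : EucSpace n) (foldingMap v x : EucSpace n) := by
  rw [coe_foldingMap, inner_sub_right, inner_smul_right, inner_self_unitSphere]
  rcases le_or_gt 0 (inner ℝ (v : EucSpace n) (x : EucSpace n)) with h | h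
  · rw [min_eq_right h]; linarith
  · rw [min_eq_left h.le]; linarith

lemma inner_le_inner_foldingMap (v x y : UnitSphere n) :
    inner ℝ (x : EucSpace n) (y : EucSpace n)
      ≤ inner ℝ (foldingMap v x : EucSpace n) (foldingMap v y : EucSpace n) := by
  simp only [coe_foldingMap, inner_sub_right, inner_sub_left, inner_smul_right, inner_smul_left,
    inner_self_unitSphere, RCLike.conj_to_real, real_inner_comm (v : EucSpace n) (x : EucSpace n)]
  generalize inner ℝ (v : EucSpace n) (x : EucSpace n) = a
  generalize inner ℝ (v : EucSpace n) (y : EucSpace n) = b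
  rcases le_total a 0 with ha | ha <;> rcases le_total b 0 with hb | hb <;>
    simp only [min_eq_left, min_eq_right, ha, hb] <;> nlinarith

lemma roundDist_foldingMap_le (v x y : UnitSphere n) :
    roundDist (foldingMap v x) (foldingMap v y) ≤ roundDist x y := by
  simp only [roundDist, InnerProductGeometry.angle, norm_eq_of_mem_sphere, mul_one, div_one]
  exact Real.arccos_le_arccos (inner_le_inner_foldingMap v x y)

namespace IsFoldingComposition

variable {f : UnitSphere n → UnitSphere n}

lemma continuous (hf : IsFoldingComposition f) : Continuous f := by
  induction hf with
  | fold v => exact continuous_foldingMap v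
  | comp v f _ ih => exact (continuous_foldingMap v).comp ih

lemma roundDist_le (hf : IsFoldingComposition f) (x y : UnitSphere n) :
    roundDist (f x) (f y) ≤ roundDist x y := by
  induction hf with
  | fold v => exact roundDist_foldingMap_le v x y
  | comp v f _ ih => exact (roundDist_foldingMap_le v _ _).trans ih

/-- The image of a composition of folds lies in the closed hemisphere of the last one. -/
lemma exists_inner_nonneg (hf : IsFoldingComposition f) :
    ∃ v : UnitSphere n, ∀ x, 0 ≤ inner ℝ (v : EucSpace n) (f x : EucSpace n) := by
  cases hf with
  | fold v => exact ⟨v, inner_foldingMap_nonneg v⟩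
  | comp v f _ => exact ⟨v, fun x => inner_foldingMap_nonneg v (f x)⟩

end IsFoldingComposition

end Folding

/-! ### Degree -/

section Degree

variable {n : ℕ}

/-- The straight line homotopy to `v`, pushed radially onto the sphere; it avoids the origin
because its inner product with `v` is positive at positive times. -/
lemma homotopic_const_of_inner_nonneg {h : C(UnitSphere n, UnitSphere n)} {v : UnitSphere n}
    (hv : ∀ x, 0 ≤ inner ℝ (v : EucSpace n) (h x : EucSpace n)) :
    h.Homotopic (ContinuousMap.const _ v) := by
  let F : unitInterval × UnitSphere n → EucSpace n := fun q =>
    (1 - (q.1 : ℝ)) • (h q.2 : EucSpace n) + (q.1 : ℝ) • (v : EucSpace n)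
  have hFc : Continuous F := by fun_prop
  have hF : ∀ q, F q ≠ 0 := by
    rintro ⟨t, x⟩ h0
    have h1 : inner ℝ (v : EucSpace n) (F (t, x)) = 0 := by rw [h0, inner_zero_right]
    simp only [F, inner_add_right, inner_smul_right, inner_self_unitSphere] at h1
    have ht0 : (t : ℝ) = 0 := by
      have := mul_nonneg (sub_nonneg.2 t.2.2) (hv x)
      linarith [t.2.1]
    have h2 : (h x : EucSpace n) = 0 := by simpa [F, ht0] using h0
    have h3 := norm_eq_of_mem_sphere (h x)
    rw [h2, norm_zero] at h3
    exact zero_ne_one h3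
  refine ⟨⟨⟨fun q => ⟨‖F q‖⁻¹ • F q, ?_⟩, ?_⟩, ?_, ?_⟩⟩
  · rw [mem_sphere_zero_iff_norm, norm_smul, norm_inv, norm_norm,
      inv_mul_cancel₀ (norm_ne_zero_iff.2 (hF q))]
  · exact Continuous.subtype_mk
      ((hFc.norm.inv₀ fun q => norm_ne_zero_iff.2 (hF q)).smul hFc) _
  · intro x
    ext1
    simp [F]
  · intro x
    ext1
    simp [F]

/-- A constant map factors through a point, whose homology vanishes in positive degrees. -/
lemma topHomologyMap_const (hn : n ≠ 0) (v : UnitSphere n) :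
    topHomologyMap (ContinuousMap.const _ v) = 0 := by
  have hz := AlgebraicTopology.isZero_singularHomologyFunctor_of_totallyDisconnectedSpace
    (ModuleCat.{0} ℤ) n (ModuleCat.of ℤ ℤ) (TopCat.of PUnit.{1}) hn
  have hfac : TopCat.ofHom (ContinuousMap.const (UnitSphere n) v)
      = TopCat.ofHom (ContinuousMap.const (UnitSphere n) PUnit.unit) ≫
        TopCat.ofHom (ContinuousMap.const PUnit.{1} v) := rfl
  unfold topHomologyMap
  rw [hfac, Functor.map_comp]
  exact (congrArg (· ≫ _) (hz.eq_zero_of_tgt _)).trans Limits.zero_comp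

lemma hasDegree_zero_of_inner_nonneg (hn : n ≠ 0) {h : C(UnitSphere n, UnitSphere n)}
    {v : UnitSphere n} (hv : ∀ x, 0 ≤ inner ℝ (v : EucSpace n) (h x : EucSpace n)) :
    HasDegree h 0 := by
  obtain ⟨H⟩ := homotopic_const_of_inner_nonneg hv
  have H' : TopCat.Homotopy (TopCat.ofHom h) (TopCat.ofHom (ContinuousMap.const _ v)) := H
  have key : topHomologyMap h = topHomologyMap (ContinuousMap.const _ v) :=
    H'.congr_homologyMap_singularChainComplexFunctor (ModuleCat.of ℤ ℤ) n
  intro c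
  rw [key, topHomologyMap_const hn, zero_smul]
  rfl

end Degree

/-! ### The sign of a local isometry -/

section Sign

variable {n : ℕ}

/-- Near `p`, the map `f` is the restriction of a linear isometry of determinant `s = ±1`. -/
def IsLocallyIsometryOfSign (f : UnitSphere n → UnitSphere n) (p : UnitSphere n) (s : ℤˣ) : Prop :=
  ∃ L : EucSpace n ≃ₗᵢ[ℝ] EucSpace n,
    LinearMap.det (L.toLinearEquiv : EucSpace n →ₗ[ℝ] EucSpace n) = ((s : ℤ) : ℝ) ∧
    ∀ᶠ x in 𝓝 p, (f x : EucSpace n) = L x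

namespace IsLocallyIsometryOfSign

variable {f : UnitSphere n → UnitSphere n} {p v : UnitSphere n} {s : ℤˣ}

lemma id (p : UnitSphere n) : IsLocallyIsometryOfSign id p 1 :=
  ⟨LinearIsometryEquiv.refl ℝ _, by simp, by simp⟩

lemma fold_of_pos (hs : IsLocallyIsometryOfSign f p s) (hf : Continuous f)
    (hv : 0 < inner ℝ (v : EucSpace n) (f p : EucSpace n)) :
    IsLocallyIsometryOfSign (foldingMap v ∘ f) p s := by
  obtain ⟨L, hL, hfL⟩ := hs
  refine ⟨L, hL, ?_⟩
  have hc : Continuous fun x => inner ℝ (v : EucSpace n) (f x : EucSpace n) := by fun_prop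
  filter_upwards [hfL, hc.continuousAt.eventually (lt_mem_nhds hv)] with x hx hx'
  rw [Function.comp_apply, foldingMap_of_nonneg hx'.le, hx]

lemma fold_of_neg (hs : IsLocallyIsometryOfSign f p s) (hf : Continuous f)
    (hv : inner ℝ (v : EucSpace n) (f p : EucSpace n) < 0) :
    IsLocallyIsometryOfSign (foldingMap v ∘ f) p (-s) := by
  obtain ⟨L, hL, hfL⟩ := hs
  refine ⟨L.trans (ℝ ∙ (v : EucSpace n))ᗮ.reflection, ?_, ?_⟩
  · have hv0 : (v : EucSpace n) ≠ 0 := ne_zero_of_mem_unit_sphere v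
    have hcomp : ((L.trans (ℝ ∙ (v : EucSpace n))ᗮ.reflection).toLinearEquiv :
        EucSpace n →ₗ[ℝ] EucSpace n) = (ℝ ∙ (v : EucSpace n))ᗮ.reflection.toLinearMap ∘ₗ
          (L.toLinearEquiv : EucSpace n →ₗ[ℝ] EucSpace n) := rfl
    rw [hcomp, LinearMap.det_comp, hL, Submodule.det_reflection, Submodule.orthogonal_orthogonal,
      finrank_span_singleton hv0]
    simp
  · have hc : Continuous fun x => inner ℝ (v : EucSpace n) (f x : EucSpace n) := by fun_prop
    filter_upwards [hfL, hc.continuousAt.eventually (gt_mem_nhds hv)] with x hx hx'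
    rw [Function.comp_apply, coe_foldingMap_of_neg hx', hx]
    rfl

lemma exists_specialOrthogonal (hs : IsLocallyIsometryOfSign f p 1) :
    ∃ A ∈ Matrix.specialOrthogonalGroup (Fin (n + 1)) ℝ,
      ∀ᶠ x in 𝓝 p, (f x : EucSpace n) = Matrix.toEuclideanLin A x := by
  obtain ⟨L, hL, hfL⟩ := hs
  let b := EuclideanSpace.basisFun (Fin (n + 1)) ℝ
  refine ⟨LinearMap.toMatrix b.toBasis b.toBasis (L.toLinearEquiv : EucSpace n →ₗ[ℝ] EucSpace n),
    ⟨L.toMatrix_mem_unitaryGroup b b, ?_⟩, ?_⟩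
  · change Matrix.det _ = 1
    rw [LinearMap.det_toMatrix, hL]
    simp
  · filter_upwards [hfL] with x hx
    rw [hx, Matrix.toEuclideanLin_eq_toLin_orthonormal, Matrix.toLin_toMatrix]
    rfl

end IsLocallyIsometryOfSign

end Sign

/-! ### Folding in a plane -/

section Plane

variable {n : ℕ} {u₁ u₂ : EucSpace n}

/-- The component of `x` along the plane of `u₁, u₂` is a positive multiple of
`cos θ • u₁ + sin θ • u₂`. The angle `θ` is a real number, determined up to `2π`. -/
def HasPolarAngle (u₁ u₂ x : EucSpace n) (θ : ℝ) : Prop :=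
  ∃ r > 0, inner ℝ u₁ x = r * Real.cos θ ∧ inner ℝ u₂ x = r * Real.sin θ

lemma exists_hasPolarAngle {x : EucSpace n} (hx : inner ℝ u₁ x ≠ 0) :
    ∃ θ ∈ Set.Ioc (-Real.pi) Real.pi, HasPolarAngle u₁ u₂ x θ := by
  let z : ℂ := ⟨inner ℝ u₁ x, inner ℝ u₂ x⟩
  have hz : z ≠ 0 := fun h => hx (congrArg Complex.re h)
  exact ⟨z.arg, Complex.arg_mem_Ioc z, ‖z‖, norm_pos_iff.2 hz, (Complex.norm_mul_cos_arg z).symm,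
    (Complex.norm_mul_sin_arg z).symm⟩

/-- The fold whose equator contains the direction of angle `a` and which fixes the points with
angle in `(a, a + π)`. -/
lemma exists_fold_at_angle (h₁ : ‖u₁‖ = 1) (h₂ : ‖u₂‖ = 1) (h₁₂ : inner ℝ u₁ u₂ = 0) (a : ℝ) :
    ∃ v : UnitSphere n, ∀ (x : UnitSphere n) (θ : ℝ), HasPolarAngle u₁ u₂ x θ → |θ - a| < Real.pi →
      (a < θ → 0 < inner ℝ (v : EucSpace n) (x : EucSpace n) ∧
        HasPolarAngle u₁ u₂ (foldingMap v x) θ) ∧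
      (θ < a → inner ℝ (v : EucSpace n) (x : EucSpace n) < 0 ∧
        HasPolarAngle u₁ u₂ (foldingMap v x) (2 * a - θ)) := by
  have h₁' : inner ℝ u₁ u₁ = 1 := by rw [real_inner_self_eq_norm_sq, h₁, one_pow]
  have h₂' : inner ℝ u₂ u₂ = 1 := by rw [real_inner_self_eq_norm_sq, h₂, one_pow]
  have h₂₁ : inner ℝ u₂ u₁ = 0 := by rw [real_inner_comm, h₁₂]
  let w : EucSpace n := (-Real.sin a) • u₁ + Real.cos a • u₂
  have hw : ‖w‖ = 1 := by
    have : ‖w‖ ^ 2 = 1 := by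
      rw [← real_inner_self_eq_norm_sq]
      simp only [w, inner_add_left, inner_add_right, inner_smul_left, inner_smul_right, h₁', h₂',
        h₁₂, h₂₁, RCLike.conj_to_real]
      linear_combination Real.sin_sq_add_cos_sq a
    exact (pow_eq_one_iff_of_nonneg (norm_nonneg _) two_ne_zero).1 this
  refine ⟨⟨w, by simpa using hw⟩, ?_⟩
  rintro x θ ⟨r, hr, hc, hs⟩ hθ
  have hi : inner ℝ w (x : EucSpace n) = r * Real.sin (θ - a) := by
    simp only [w, inner_add_left, inner_smul_left, hc, hs, RCLike.conj_to_real, Real.sin_sub]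
    ring
  obtain ⟨hθ₁, hθ₂⟩ := abs_lt.1 hθ
  constructor
  · intro h
    have hpos : 0 < inner ℝ w (x : EucSpace n) := by
      rw [hi]
      exact mul_pos hr (Real.sin_pos_of_pos_of_lt_pi (sub_pos.2 h) hθ₂)
    refine ⟨hpos, ?_⟩
    rw [foldingMap_of_nonneg hpos.le]
    exact ⟨r, hr, hc, hs⟩
  · intro h
    have hneg : inner ℝ w (x : EucSpace n) < 0 := by
      rw [hi]
      exact mul_neg_of_pos_of_neg hr (Real.sin_neg_of_neg_of_neg_pi_lt (sub_neg.2 h) hθ₁)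
    refine ⟨hneg, r, hr, ?_⟩
    rw [coe_foldingMap_of_neg hneg, reflection_orthogonal_unitSphere]
    simp only [inner_sub_right, inner_smul_right, hi]
    simp only [w, inner_add_right, inner_smul_right, h₁', h₂', h₁₂, h₂₁, hc, hs]
    rw [Real.cos_sub, Real.sin_sub, Real.sin_sub, Real.cos_two_mul', Real.sin_two_mul]
    have := Real.sin_sq_add_cos_sq a
    constructor
    · linear_combination (-(r * Real.cos θ)) * this
    · linear_combination (-(r * Real.sin θ)) * this

/-- Every point `p` of `K` is mapped by `f` to a point with polar angle in `T`, and near `p` the map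
`f` is a linear isometry whose sign is the value of `e` at that angle. -/
def HasAngularOrientation (u₁ u₂ : EucSpace n) (K : Set (UnitSphere n))
    (f : UnitSphere n → UnitSphere n) (T : Finset ℝ) (e : ℝ → ℤˣ) : Prop :=
  ∀ p ∈ K, ∃ θ ∈ T, HasPolarAngle u₁ u₂ (f p) θ ∧ IsLocallyIsometryOfSign f p (e θ)

variable {K : Set (UnitSphere n)} {f : UnitSphere n → UnitSphere n} {T : Finset ℝ} {e : ℝ → ℤˣ}

lemma HasAngularOrientation.exists_fold (h₁ : ‖u₁‖ = 1) (h₂ : ‖u₂‖ = 1) (h₁₂ : inner ℝ u₁ u₂ = 0)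
    (hf : Continuous f) (hT : HasAngularOrientation u₁ u₂ K f T e) (a : ℝ) {T' : Finset ℝ}
    {e' : ℝ → ℤˣ} (ha : ∀ θ ∈ T, θ ≠ a ∧ |θ - a| < Real.pi)
    (hgt : ∀ θ ∈ T, a < θ → θ ∈ T' ∧ e' θ = e θ)
    (hlt : ∀ θ ∈ T, θ < a → 2 * a - θ ∈ T' ∧ e' (2 * a - θ) = -e θ) :
    ∃ v : UnitSphere n, HasAngularOrientation u₁ u₂ K (foldingMap v ∘ f) T' e' := by
  obtain ⟨v, hv⟩ := exists_fold_at_angle h₁ h₂ h₁₂ a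
  refine ⟨v, fun p hp => ?_⟩
  obtain ⟨θ, hθT, hθ, hs⟩ := hT p hp
  obtain ⟨hne, hpi⟩ := ha θ hθT
  rcases hne.lt_or_gt with h | h
  · obtain ⟨hneg, hang⟩ := (hv (f p) θ hθ hpi).2 h
    obtain ⟨hm, he⟩ := hlt θ hθT h
    exact ⟨_, hm, hang, he ▸ hs.fold_of_neg hf hneg⟩
  · obtain ⟨hpos, hang⟩ := (hv (f p) θ hθ hpi).1 h
    obtain ⟨hm, he⟩ := hgt θ hθT h
    exact ⟨_, hm, hang, he ▸ hs.fold_of_pos hf hpos⟩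

/-- A first fold at a small generic angle `a > 0`: no angle `θ` becomes, when reflected, equal to
another angle `θ'`, since `2 * a ≠ θ + θ'`. -/
lemma exists_generic_fold (h₁ : ‖u₁‖ = 1) (h₂ : ‖u₂‖ = 1) (h₁₂ : inner ℝ u₁ u₂ = 0)
    (hK : K.Finite) (hu : ∀ p ∈ K, inner ℝ u₁ (p : EucSpace n) ≠ 0) :
    ∃ (v : UnitSphere n) (a : ℝ) (T : Finset ℝ) (e : ℝ → ℤˣ),
      (∀ θ ∈ T, θ ∈ Set.Ioo a (a + Real.pi)) ∧
      HasAngularOrientation u₁ u₂ K (foldingMap v) T e := by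
  classical
  choose! θ hθmem hθ using fun p (hp : p ∈ K) => exists_hasPolarAngle (u₂ := u₂) (hu p hp)
  let T₀ : Finset ℝ := hK.toFinset.image θ
  have hT₀ : ∀ t ∈ T₀, t ∈ Set.Ioc (-Real.pi) Real.pi := by
    intro t ht
    obtain ⟨p, hp, rfl⟩ := Finset.mem_image.1 ht
    exact hθmem p (hK.mem_toFinset.1 hp)
  have hev : ∀ᶠ a in 𝓝[>] (0 : ℝ), (∀ t ∈ T₀, a < t + Real.pi) ∧
      ∀ t ∈ T₀, ∀ t' ∈ T₀, a ≠ (t + t') / 2 := by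
    refine Eventually.and ?_ ?_
    · refine (eventually_all_finset T₀).2 fun t ht => ?_
      exact nhdsWithin_le_nhds (gt_mem_nhds (by linarith [(hT₀ t ht).1]))
    · refine (eventually_all_finset T₀).2 fun t _ => (eventually_all_finset T₀).2 fun t' _ => ?_
      rcases eq_or_ne ((t + t') / 2) 0 with h | h
      · filter_upwards [self_mem_nhdsWithin] with a (ha : 0 < a)
        exact h ▸ ha.ne'
      · exact nhdsWithin_le_nhds (isOpen_ne.mem_nhds h.symm)
  obtain ⟨a, ⟨ha, hgen⟩, ha0 : 0 < a⟩ := (hev.and self_mem_nhdsWithin).exists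
  have hne : ∀ t ∈ T₀, t ≠ a := fun t ht h => hgen t ht t ht (by rw [h]; ring)
  have hpi : ∀ t ∈ T₀, |t - a| < Real.pi := fun t ht =>
    abs_lt.2 ⟨by linarith [ha t ht], by linarith [(hT₀ t ht).2]⟩
  have hstart : HasAngularOrientation u₁ u₂ K id T₀ fun _ => 1 := fun p hp =>
    ⟨θ p, Finset.mem_image_of_mem θ (hK.mem_toFinset.2 hp), hθ p hp, .id p⟩
  have hfold := hstart.exists_fold h₁ h₂ h₁₂ continuous_id a
    (T' := T₀.image fun t => a + |t - a|) (e' := fun t => if t ∈ T₀ then 1 else -1)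
    (fun t ht => ⟨hne t ht, hpi t ht⟩)
    (fun t ht h => ⟨Finset.mem_image.2 ⟨t, ht, by rw [abs_of_pos (sub_pos.2 h)]; ring⟩, if_pos ht⟩)
    (fun t ht h => ⟨Finset.mem_image.2 ⟨t, ht, by rw [abs_of_neg (sub_neg.2 h)]; ring⟩,
      if_neg fun h' => hgen t ht _ h' (by ring)⟩)
  obtain ⟨v, hv⟩ := hfold
  refine ⟨v, a, _, _, fun t ht => ?_, hv⟩
  obtain ⟨t', ht', rfl⟩ := Finset.mem_image.1 ht
  exact ⟨by linarith [abs_pos.2 (sub_ne_zero.2 (hne t' ht'))], by linarith [hpi t' ht']⟩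

/-- Once the sign is a function of the angle and the angles lie in an open half-circle, finitely
many further folds make all signs equal to `1`. -/
lemma exists_foldingComposition_sign_eq_one (h₁ : ‖u₁‖ = 1) (h₂ : ‖u₂‖ = 1)
    (h₁₂ : inner ℝ u₁ u₂ = 0) {c : ℝ} (hf : IsFoldingComposition f)
    (hTc : ∀ θ ∈ T, θ ∈ Set.Ioo c (c + Real.pi)) (hT : HasAngularOrientation u₁ u₂ K f T e) :
    ∃ g : UnitSphere n → UnitSphere n, IsFoldingComposition g ∧
      ∀ p ∈ K, IsLocallyIsometryOfSign g p 1 := by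
  classical
  induction hm : T.card generalizing T e f with
  | zero =>
    rw [Finset.card_eq_zero] at hm
    refine ⟨f, hf, fun p hp => ?_⟩
    obtain ⟨θ, hθ, -⟩ := hT p hp
    simp [hm] at hθ
  | succ m ih =>
    have hne : T.Nonempty := Finset.card_pos.1 (by omega)
    set t₁ := T.min' hne with ht₁
    have ht₁T : t₁ ∈ T := T.min'_mem hne
    have ht₁c := hTc t₁ ht₁T
    rcases (T.erase t₁).eq_empty_or_nonempty with hemp | hne'
    · have hall : ∀ θ ∈ T, θ = t₁ := fun θ hθ => by
        by_contra h
        simpa [hemp] using Finset.mem_erase.2 ⟨h, hθ⟩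
      rcases Int.units_eq_one_or (e t₁) with h1 | h1
      · refine ⟨f, hf, fun p hp => ?_⟩
        obtain ⟨θ, hθ, -, hs⟩ := hT p hp
        rwa [hall θ hθ, h1] at hs
      -- A single angle with sign `-1` is flipped by a fold at any angle in `(t₁, t₁ + π)`.
      · obtain ⟨v, hv⟩ := hT.exists_fold h₁ h₂ h₁₂ hf.continuous (t₁ + 1)
          (T' := {t₁ + 2}) (e' := fun _ => 1)
          (fun θ hθ => by
            rw [hall θ hθ]
            refine ⟨by linarith, ?_⟩
            rw [show t₁ - (t₁ + 1) = -1 by ring, abs_neg, abs_one]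
            linarith [Real.pi_gt_three])
          (fun θ hθ h => by rw [hall θ hθ] at h; linarith)
          (fun θ hθ _ => by
            rw [hall θ hθ, h1, neg_neg]
            exact ⟨Finset.mem_singleton.2 (by ring), rfl⟩)
        refine ⟨_, .comp v f hf, fun p hp => ?_⟩
        obtain ⟨θ, -, -, hs⟩ := hv p hp
        exact hs
    · set t₂ := (T.erase t₁).min' hne' with ht₂
      have ht₂T' : t₂ ∈ T.erase t₁ := (T.erase t₁).min'_mem hne'
      have ht₂T : t₂ ∈ T := Finset.mem_of_mem_erase ht₂T'
      have ht₂c := hTc t₂ ht₂T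
      have ht₁₂ : t₁ < t₂ :=
        lt_of_le_of_ne (T.min'_le t₂ ht₂T) (Finset.ne_of_mem_erase ht₂T').symm
      have hrest : ∀ θ ∈ T, θ ≠ t₁ → t₂ ≤ θ := fun θ hθ h =>
        (T.erase t₁).min'_le θ (Finset.mem_erase.2 ⟨h, hθ⟩)
      have herase : (T.erase t₁).card = m := by rw [Finset.card_erase_of_mem ht₁T, hm]; rfl
      -- Folding an angle `t < t₂` at the midpoint onto `t₂` removes it if its sign is opposite.
      have merge : ∀ (t : ℝ) (f' : UnitSphere n → UnitSphere n) (e' : ℝ → ℤˣ), c < t → t < t₂ →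
          e' t₂ = -e' t → IsFoldingComposition f' →
          HasAngularOrientation u₁ u₂ K f' (insert t (T.erase t₁)) e' →
          ∃ g : UnitSphere n → UnitSphere n, IsFoldingComposition g ∧
            ∀ p ∈ K, IsLocallyIsometryOfSign g p 1 := by
        intro t f' e' hct htt₂ he' hf' hT'
        have hcase : ∀ θ ∈ insert t (T.erase t₁), θ = t ∨ (θ ∈ T.erase t₁ ∧ t₂ ≤ θ ∧
            θ < c + Real.pi) := by
          intro θ hθ
          rcases Finset.mem_insert.1 hθ with h | h
          · exact .inl h
          · have hθT := Finset.mem_of_mem_erase h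
            exact .inr ⟨h, hrest θ hθT (Finset.ne_of_mem_erase h), (hTc θ hθT).2⟩
        obtain ⟨v, hv⟩ := hT'.exists_fold h₁ h₂ h₁₂ hf'.continuous ((t + t₂) / 2)
          (T' := T.erase t₁) (e' := e')
          (fun θ hθ => by
            rcases hcase θ hθ with rfl | ⟨-, h, h'⟩
            · exact ⟨by linarith, abs_lt.2 ⟨by linarith [ht₂c.2], by linarith [ht₂c.2]⟩⟩
            · exact ⟨by linarith, abs_lt.2 ⟨by linarith [ht₂c.2], by linarith [ht₂c.2]⟩⟩)
          (fun θ hθ h => by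
            rcases hcase θ hθ with rfl | ⟨h', -, -⟩
            · linarith
            · exact ⟨h', rfl⟩)
          (fun θ hθ h => by
            rcases hcase θ hθ with rfl | ⟨-, h', -⟩
            · rw [show 2 * ((θ + t₂) / 2) - θ = t₂ by ring]
              exact ⟨ht₂T', he'⟩
            · linarith)
        exact ih (.comp v f' hf') (fun θ hθ => hTc θ (Finset.mem_of_mem_erase hθ)) hv herase
      by_cases he : e t₂ = e t₁
      · -- The fold at a quarter of the way moves `t₁` to the midpoint and flips its sign.
        have hmid : t₁ < (t₁ + t₂) / 2 ∧ (t₁ + t₂) / 2 < t₂ := ⟨by linarith, by linarith⟩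
        obtain ⟨v, hv⟩ := hT.exists_fold h₁ h₂ h₁₂ hf.continuous (t₁ + (t₂ - t₁) / 4)
          (T' := insert ((t₁ + t₂) / 2) (T.erase t₁))
          (e' := Function.update e ((t₁ + t₂) / 2) (-e t₁))
          (fun θ hθ => by
            have hθc := hTc θ hθ
            have h₁c := ht₁c.1
            have h₂c := ht₂c.2
            by_cases h : θ = t₁
            · subst h
              exact ⟨by linarith, abs_lt.2 ⟨by linarith, by linarith⟩⟩
            · have := hrest θ hθ h
              exact ⟨by linarith, abs_lt.2 ⟨by linarith [hθc.2], by linarith [hθc.2]⟩⟩)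
          (fun θ hθ h => by
            have h' : θ ≠ t₁ := by rintro rfl; linarith
            have h'' := hrest θ hθ h'
            exact ⟨Finset.mem_insert_of_mem (Finset.mem_erase.2 ⟨h', hθ⟩),
              Function.update_of_ne (by linarith) _ _⟩)
          (fun θ hθ h => by
            have h' : θ = t₁ := by
              by_contra h'
              linarith [hrest θ hθ h']
            rw [h', show 2 * (t₁ + (t₂ - t₁) / 4) - t₁ = (t₁ + t₂) / 2 by ring]
            exact ⟨Finset.mem_insert_self _ _, Function.update_self ..⟩)
        refine merge _ _ _ (by linarith [ht₁c.1]) hmid.2 ?_ (.comp v f hf) hv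
        rw [Function.update_self, Function.update_of_ne hmid.2.ne', neg_neg, he]
      · refine merge t₁ f e ht₁c.1 ht₁₂ (Int.units_ne_iff_eq_neg.1 he) hf ?_
        rwa [Finset.insert_erase ht₁T]

end Plane

/-! ### The wrapping map -/

section Wrapping

variable {n : ℕ}

/-- Finitely many hyperplanes `pᗮ` do not cover the space. -/
lemma exists_norm_eq_one_inner_ne_zero {K : Set (UnitSphere n)} (hK : K.Finite) :
    ∃ u : EucSpace n, ‖u‖ = 1 ∧ ∀ p ∈ K, inner ℝ u (p : EucSpace n) ≠ 0 := by
  classical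
  -- The zero subspace is added so that the vector found is nonzero also for empty `K`.
  let s : Finset (Submodule ℝ (EucSpace n)) :=
    insert ⊥ (hK.toFinset.image fun p : UnitSphere n => (ℝ ∙ (p : EucSpace n))ᗮ)
  have hs : ⊤ ∉ s := by
    intro h
    rcases Finset.mem_insert.1 h with h | h
    · exact top_ne_bot h
    · obtain ⟨p, -, hp⟩ := Finset.mem_image.1 h
      rw [Submodule.orthogonal_eq_top_iff, Submodule.span_singleton_eq_bot] at hp
      exact ne_zero_of_mem_unit_sphere p hp
  obtain ⟨w, hw⟩ := (Set.ne_univ_iff_exists_notMem _).1 (Subspace.biUnion_ne_univ_of_top_notMem hs)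
  simp only [s, Set.mem_iUnion, not_exists, Finset.mem_insert, Finset.mem_image] at hw
  have hw0 : w ≠ 0 := fun h => hw ⊥ (.inl rfl) (by simp [h])
  refine ⟨‖w‖⁻¹ • w, norm_smul_inv_norm hw0, fun p hp h => ?_⟩
  rw [inner_smul_left] at h
  have h' : inner ℝ w (p : EucSpace n) = 0 :=
    (mul_eq_zero.1 h).resolve_left (by simpa using hw0)
  exact hw _ (.inr ⟨p, hK.mem_toFinset.2 hp, rfl⟩)
    (Submodule.mem_orthogonal_singleton_iff_inner_left.2 h')

lemma exists_norm_eq_one_inner_eq_zero (hn : 1 ≤ n) (u : EucSpace n) :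
    ∃ w : EucSpace n, ‖w‖ = 1 ∧ inner ℝ u w = 0 := by
  have hne : (ℝ ∙ u)ᗮ ≠ ⊥ := by
    intro h
    have h1 := Submodule.finrank_add_finrank_orthogonal (ℝ ∙ u)
    have h2 : Module.finrank ℝ (ℝ ∙ u) ≤ 1 := (finrank_span_le_card {u}).trans (by simp)
    rw [h, finrank_bot, finrank_euclideanSpace_fin] at h1
    omega
  obtain ⟨w, hw, hw0⟩ := Submodule.exists_mem_ne_zero_of_ne_bot hne
  refine ⟨‖w‖⁻¹ • w, norm_smul_inv_norm hw0, ?_⟩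
  rw [inner_smul_right, Submodule.mem_orthogonal_singleton_iff_inner_right.1 hw, mul_zero]

end Wrapping

/-- Every finite subset of `𝕊ⁿ`, `n ≥ 1`, has the wrapping property, with a wrapping map that is a
composition of folding maps and equals an element of `SO(n+1)` near each point of the set. -/
theorem mainTheorem6 (n : ℕ) (hn : 1 ≤ n) (K : Set (UnitSphere n)) (hK : K.Finite) :
    ∃ h : C(UnitSphere n, UnitSphere n),
      IsWrappingMap K h ∧
      (∀ p ∈ K, ∃ A ∈ Matrix.specialOrthogonalGroup (Fin (n + 1)) ℝ,
        ∀ᶠ x in 𝓝 p, (h x : EucSpace n) = Matrix.toEuclideanLin A x) ∧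
      IsFoldingComposition (h : UnitSphere n → UnitSphere n) := by
  obtain ⟨u₁, h₁, hu⟩ := exists_norm_eq_one_inner_ne_zero hK
  obtain ⟨u₂, h₂, h₁₂⟩ := exists_norm_eq_one_inner_eq_zero hn u₁
  obtain ⟨v, a, T, e, hTa, hT⟩ := exists_generic_fold h₁ h₂ h₁₂ hK hu
  obtain ⟨g, hg, hsign⟩ := exists_foldingComposition_sign_eq_one h₁ h₂ h₁₂ (.fold v) hTa hT
  obtain ⟨w, hw⟩ := hg.exists_inner_nonneg
  have hrot := fun p hp => (hsign p hp).exists_specialOrthogonal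
  refine ⟨⟨g, hg.continuous⟩, ⟨hg.roundDist_le, ⟨0, ?_, zero_ne_one⟩, fun p hp => ?_⟩, hrot, hg⟩
  · exact hasDegree_zero_of_inner_nonneg (by omega) hw
  · obtain ⟨A, hA, hgA⟩ := hrot p hp
    refine ⟨A, hA, fun x hx => ?_⟩
    -- A connected component of a finite set is a single point.
    have hsub : (connectedComponentIn K p).Subsingleton :=
      hK.countable.isTotallyDisconnected _ (connectedComponentIn_subset K p)
        isPreconnected_connectedComponentIn
    rw [hsub hx (mem_connectedComponentIn hp)]
    exact hgA.self_of_nhds
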